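/- **Conventions.** A *metric family* is a set of metric spaces. A *map of metric families* $F\colon\mathcal X\to\mathcal Y$ is a collection of functions $f\colon X\to Y$ with $X\in\mathcal X$, $Y\in\mathcal Y$, such that every $X\in\mathcal X$ is the domain of at least one $f\in F$. It is a *coarse embedding* if there are non-decreasing functions $\delta,\varrho\colon[0,\infty)\to[0,\infty)$ tending to $\infty$ at $\infty$ with $\delta(d_X(x,y))\le d_Y(f(x),f(y))\le\varrho(d_X(x,y))$ for all $f\colon X\to Y$ in $F$ and all $x,y\in X$. For $r>0$ and an integer $n\ge0$, $\mathcal X$ is *$(r,n)$-decomposable* over $\mathcal Y$ if every $X\in\mathcal X$ can be written $X=X_0\cup\dots\cup X_n$, where each $X_i$ is a disjoint union of subspaces $X_{ij}\in\mathcal Y$ any two of which are at distance more than $r$. For a collection $\mathfrak C$ of metric families, $\mathcal X$ is *$n$-decomposable over $\mathfrak C$* if for every $r>0$ it is $(r,n)$-decomposable over some $\mathcal Y\in\mathfrak C$. The collection $\mathfrak C$ * satisfies *Coarse Permanence* if $\mathcal X\in\mathfrak C$ whenever there is a coarse embedding $\mathcal X\to\mathcal Y$ with $\mathcal Y\in\mathfrak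 C$; * satisfies *Finite Amalgamation Permanence* if $\mathcal X_1\cup\dots\cup\mathcal X_m\in\mathfrak C$ whenever $m\ge1$ and $\mathcal X_1,\dots,\mathcal X_m\in\mathfrak C$; * satisfies *Finite Union Permanence* if $\mathcal X\in\mathfrak C$ whenever $m\ge1$, $\mathcal X_1,\dots,\mathcal X_m\in\mathfrak C$, and every $X\in\mathcal X$ is a union $X=X_1\cup\dots\cup X_m$ of subspaces $X_i\in\mathcal X_i$; * is *stable under weak decomposition* if $\mathcal X\in\mathfrak C$ whenever $\mathcal X$ is $n$-decomposable over $\mathfrak C$ for some $n\ge0$. A metric on a group is *proper* if its balls are finite. A single metric space $Y$ is in $\mathfrak C$, or is $n$-decomposable over $\mathfrak C$, if the family $\{Y\}$ is. A countable group is in $\mathfrak C$, or is $n$-decomposable over $\mathfrak C$, if this holds with respect to every proper left invariant metric on it. A *uniform simplicial complex* is the geometric realization $E=|K|$ of an abstract simplicial complex $K$, in barycentric coordinates, with the $\ell^1$-metric $d^1(x,y)=\sum_v|x_v-y_v|$. A *simplicial $G$-action* on it is an action on the vertex set that maps simplices to simplices; it induces the action $(gx)_v=x_{g^{-1}v}$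 on $E$. **Theorem.** Let $\mathfrak C$ be a collection of metric families that satisfies Coarse Permanence, Finite Amalgamation Permanence and Finite Union Permanence. Let $G$ be a countable group with a proper left invariant metric $\rho$, and let $n$ be a non-negative integer. Assume that for every $\varepsilon>0$ there are a non-empty compact space $X$ with an action of $G$ by homeomorphisms, a uniform simplicial complex $E$ with a simplicial $G$-action, and a continuous map $f\colon X\to E$ such that 1. $\dim E\le n$; 2. $d^1(f(gx),g f(x))\le\varepsilon\,\rho(e,g)$ for all $g\in G$ and $x\in X$; 3. for each vertex $v$ of $E$, the stabilizer $G_v=\{g\in G\mid gv=v\}$, as a metric subspace of $(G,\rho)$, is in $\mathfrak C$. Then $G$ is $n$-decomposable over $\mathfrak C$. If, moreover, $\mathfrak C$ is stable under weak decomposition, then $G$ is in $\mathfrak C$. -/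

import Mathlib

open scoped NNReal

noncomputable section

namespace CoarseFamilies

universe u v w

/-! ### Metric families -/

/-- A (possibly empty) metric space, bundled. -/
structure MetSpc : Type (u + 1) where
  carrier : Type u
  metric : MetricSpace carrier

instance : CoeSort MetSpc.{u} (Type u) := ⟨MetSpc.carrier⟩

instance (X : MetSpc.{u}) : MetricSpace X := X.metric

/-- A subset of a metric space, as a metric subspace. -/
def MetSpc.sub {X : Type u} [MetricSpace X] (S : Set X) : MetSpc.{u} := ⟨S, inferInstance⟩

/-- A metric family: a set (not a proper class, relative to the universe of the spaces) whose
elements are metric spaces. -/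
structure MetricFamily : Type (u + 1) where
  members : Set MetSpc.{u}
  small : Small.{u} members

instance : Membership MetSpc.{u} MetricFamily.{u} := ⟨fun 𝒳 X => X ∈ 𝒳.members⟩

/-- The metric family with a single element `X`. -/
def MetricFamily.single (X : MetSpc.{u}) : MetricFamily.{u} := ⟨{X}, inferInstance⟩

/-- A map of metric families `𝒳 → 𝒴`: a collection of functions `X → Y` with `X ∈ 𝒳` and `Y ∈ 𝒴`
such that every `X ∈ 𝒳` is the domain of at least one of them. -/
structure FamilyMap (𝒳 𝒴 : MetricFamily.{u}) where
  maps : ∀ (X : 𝒳.members) (Y : 𝒴.members), Set (X.1 → Y.1)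
  exists_map : ∀ X, ∃ Y, (maps X Y).Nonempty

/-- `F` is a coarse embedding of metric families. -/
def FamilyMap.IsCoarseEmbedding {𝒳 𝒴 : MetricFamily.{u}} (F : FamilyMap 𝒳 𝒴) : Prop :=
  ∃ δ ϱ : ℝ≥0 → ℝ≥0, Monotone δ ∧ Monotone ϱ ∧
    Filter.Tendsto δ Filter.atTop Filter.atTop ∧ Filter.Tendsto ϱ Filter.atTop Filter.atTop ∧
    ∀ (X : 𝒳.members) (Y : 𝒴.members), ∀ f ∈ F.maps X Y, ∀ x y : X.1,
      δ (nndist x y) ≤ nndist (f x) (f y) ∧ nndist (f x) (f y) ≤ ϱ (nndist x y)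

/-! ### Decomposition -/

/-- A set `𝒰` of subsets of `X` is `r`-disjoint: distinct members are at distance more than `r`. -/
def RDisjoint {X : Type u} [MetricSpace X] (r : ℝ) (𝒰 : Set (Set X)) : Prop :=
  ∀ S ∈ 𝒰, ∀ T ∈ 𝒰, S ≠ T → ∀ x ∈ S, ∀ y ∈ T, r < dist x y

/-- `𝒳` is `(r, n)`-decomposable over `𝒴`: each `X ∈ 𝒳` is `X₀ ∪ ⋯ ∪ Xₙ`, where each `Xᵢ` is the
union of an `r`-disjoint set `𝒰 i` of subspaces that belong to `𝒴`. -/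
def RNDecomposable (r : ℝ) (n : ℕ) (𝒳 𝒴 : MetricFamily.{u}) : Prop :=
  ∀ X ∈ 𝒳, ∃ 𝒰 : Fin (n + 1) → Set (Set X),
    (⋃ i, ⋃₀ 𝒰 i) = Set.univ ∧
    ∀ i, RDisjoint r (𝒰 i) ∧ ∀ S ∈ 𝒰 i, MetSpc.sub S ∈ 𝒴

/-- `𝒳` is `n`-decomposable over the collection `𝔆`. -/
def NDecomposable (n : ℕ) (𝒳 : MetricFamily.{u}) (𝔆 : Set MetricFamily.{u}) : Prop :=
  ∀ r : ℝ, 0 < r → ∃ 𝒴 ∈ 𝔆, RNDecomposable r n 𝒳 𝒴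

/-- `𝒳` is weakly decomposable over the collection `𝔆`. -/
def WeaklyDecomposable (𝒳 : MetricFamily.{u}) (𝔆 : Set MetricFamily.{u}) : Prop :=
  ∃ n : ℕ, NDecomposable n 𝒳 𝔆

/-! ### Permanence properties of a collection of metric families -/

def CoarsePermanence (𝔆 : Set MetricFamily.{u}) : Prop :=
  ∀ (𝒳 𝒴 : MetricFamily.{u}) (F : FamilyMap 𝒳 𝒴), 𝒴 ∈ 𝔆 → F.IsCoarseEmbedding → 𝒳 ∈ 𝔆

def FiniteAmalgamationPermanence (𝔆 : Set MetricFamily.{u}) : Prop :=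
  ∀ (n : ℕ), 1 ≤ n → ∀ (𝒳 : MetricFamily.{u}) (𝒳s : Fin n → MetricFamily.{u}),
    𝒳.members = ⋃ i, (𝒳s i).members → (∀ i, 𝒳s i ∈ 𝔆) → 𝒳 ∈ 𝔆

def FiniteUnionPermanence (𝔆 : Set MetricFamily.{u}) : Prop :=
  ∀ (n : ℕ), 1 ≤ n → ∀ (𝒳 : MetricFamily.{u}) (𝒳s : Fin n → MetricFamily.{u}),
    (∀ i, 𝒳s i ∈ 𝔆) →
    (∀ X ∈ 𝒳, ∃ S : Fin n → Set X, (∀ i, MetSpc.sub (S i) ∈ 𝒳s i) ∧ (⋃ i, S i) = Set.univ) →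
    𝒳 ∈ 𝔆

def StableUnderWeakDecomposition (𝔆 : Set MetricFamily.{u}) : Prop :=
  ∀ 𝒳 : MetricFamily.{u}, WeaklyDecomposable 𝒳 𝔆 → 𝒳 ∈ 𝔆

/-! ### Groups with a proper left invariant metric -/

/-- The metric `ρ` on the group `G` is left invariant, and its balls are finite. -/
def IsProperLeftInvariant {G : Type u} [Group G] (ρ : MetricSpace G) : Prop :=
  (∀ g x y : G, dist (g * x) (g * y) = dist x y) ∧
    ∀ (x : G) (r : ℝ), (Metric.closedBall x r).Finite

/-- The group `G` is `n`-decomposable over `𝔆`, with respect to any proper left invariant metric. -/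
def GroupNDecomposable (n : ℕ) (G : Type u) [Group G] (𝔆 : Set MetricFamily.{u}) : Prop :=
  ∀ ρ : MetricSpace G, IsProperLeftInvariant ρ → NDecomposable n (MetricFamily.single ⟨G, ρ⟩) 𝔆

/-- The group `G` is in `𝔆`, with respect to any proper left invariant metric. -/
def GroupMem (G : Type u) [Group G] (𝔆 : Set MetricFamily.{u}) : Prop :=
  ∀ ρ : MetricSpace G, IsProperLeftInvariant ρ → MetricFamily.single ⟨G, ρ⟩ ∈ 𝔆

/-- `f : X → Y` is `G`-equivariant up to `ε`, where `dist 1 g` is the norm of `g`. -/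
def EquivariantUpTo (G : Type u) [Group G] [MetricSpace G] {X : Type v} [MulAction G X]
    {Y : Type w} [MetricSpace Y] [MulAction G Y] [IsIsometricSMul G Y]
    (ε : ℝ) (f : X → Y) : Prop :=
  ∀ (g : G) (x : X), dist (f (g • x)) (g • f x) ≤ ε * dist (1 : G) g

/-! ### Uniform simplicial complexes -/

/-- The `ℓ¹`-norm of a finitely supported function. -/
def l1norm {V : Type w} (f : V →₀ ℝ) : ℝ := f.sum fun _ a => |a|

lemma l1norm_eq {V : Type w} (f : V →₀ ℝ) (s : Finset V) (h : f.support ⊆ s) :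
    l1norm f = ∑ v ∈ s, |f v| :=
  Finsupp.sum_of_support_subset f h _ (by simp)

/-- The geometric realization `|K|` of a simplicial complex `K`, in barycentric coordinates. -/
def Realization {V : Type w} (K : AbstractSimplicialComplex V) : Type w :=
  {f : V →₀ ℝ // (∀ v, 0 ≤ f v) ∧ (f.sum fun _ a => a) = 1 ∧ f.support ∈ K.faces}

/-- The uniform metric on `|K|`, which is the `ℓ¹`-metric. -/
instance {V : Type w} (K : AbstractSimplicialComplex V) : MetricSpace (Realization K) where
  dist x y := l1norm (x.1 - y.1)
  dist_self x := by simp [l1norm]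
  dist_comm x y := by
    classical
    rw [← neg_sub, l1norm, l1norm, Finsupp.sum_neg_index (by simp)]
    simp
  dist_triangle x y z := by
    classical
    have key : ∀ a b : V →₀ ℝ, l1norm (a + b) ≤ l1norm a + l1norm b := by
      intro a b
      rw [l1norm_eq (a + b) (a.support ∪ b.support) Finsupp.support_add,
        l1norm_eq a (a.support ∪ b.support) Finset.subset_union_left,
        l1norm_eq b (a.support ∪ b.support) Finset.subset_union_right, ← Finset.sum_add_distrib]
      exact Finset.sum_le_sum fun v _ => abs_add_le _ _
    have := key (x.1 - y.1) (y.1 - z.1)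
    rwa [sub_add_sub_cancel] at this
  eq_of_dist_eq_zero := by
    intro x y h
    apply Subtype.ext
    rw [← sub_eq_zero]
    ext v
    by_contra hv
    have hpos : 0 < l1norm (x.1 - y.1) :=
      Finset.sum_pos (fun w hw => abs_pos.2 (Finsupp.mem_support_iff.1 hw))
        ⟨v, Finsupp.mem_support_iff.2 hv⟩
    exact hpos.ne' h

/-- `dim K ≤ n`: an `n`-simplex has `n + 1` vertices. -/
def DimLE {V : Type w} (K : AbstractSimplicialComplex V) (n : ℕ) : Prop :=
  ∀ σ ∈ K.faces, σ.card ≤ n + 1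

/-- The action of `G` on the vertex set is a simplicial action on `K`: it maps simplices to
simplices (of the same dimension). -/
class IsSimplicialAction (G : Type u) [Group G] {V : Type w} [MulAction G V]
    (K : AbstractSimplicialComplex V) : Prop where
  map_mem : ∀ (g : G), ∀ σ ∈ K.faces, σ.map (MulAction.toPerm g).toEmbedding ∈ K.faces

section Action

variable {G : Type u} [Group G] {V : Type w} [MulAction G V] (K : AbstractSimplicialComplex V)
  [IsSimplicialAction G K]

/-- The action of `G` on `|K|`, given by `(g f)(s) = f (g⁻¹ s)`. -/
instance : MulAction G (Realization K) where
  smul g x := ⟨x.1.equivMapDomain (MulAction.toPerm g), by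
    refine ⟨fun v => x.2.1 _, ?_, ?_⟩
    · rw [Finsupp.sum_equivMapDomain]
      exact x.2.2.1
    · exact IsSimplicialAction.map_mem g _ x.2.2.2⟩
  one_smul x := by
    apply Subtype.ext
    ext v
    change x.1 ((1 : G)⁻¹ • v) = x.1 v
    simp
  mul_smul g h x := by
    apply Subtype.ext
    ext v
    change x.1 ((g * h)⁻¹ • v) = x.1 (h⁻¹ • g⁻¹ • v)
    rw [mul_inv_rev, mul_smul]

lemma smul_realization_apply (g : G) (x : Realization K) (s : V) :
    (g • x).1 s = x.1 (g⁻¹ • s) := rfl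

instance : IsIsometricSMul G (Realization K) where
  isometry_smul g := by
    refine Isometry.of_dist_eq fun x y => ?_
    have h : (g • x).1 - (g • y).1 = (x.1 - y.1).equivMapDomain (MulAction.toPerm g) := by
      ext v
      rfl
    change l1norm ((g • x).1 - (g • y).1) = l1norm (x.1 - y.1)
    rw [h, l1norm, Finsupp.sum_equivMapDomain, l1norm]

end Action

end CoarseFamilies

end

/-!
Fix `r > 0` and a base point `p : X`. For a map `f : X → E` that is equivariant up to `ε`, the map
`φ g = g • f (g⁻¹ • p)` from `G` to `E` is `ε`-Lipschitz (`dist_twistedOrbit_le`), so the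
decomposition of `G` is obtained by pulling back one of `E`.

For a finite set `σ` of vertices let `gapSet E δ σ` be the set of the points of `E` whose coordinates
in `σ` are at least `δ` and exceed all other coordinates by at least `δ`. If `dim E ≤ n` and
`δ = 1 / (n + 1) ^ 2`, these sets cover `E` as `σ` ranges over the sets of at most `n + 1` vertices
(`exists_mem_gapSet`), and for distinct `σ`, `τ` of the same cardinality they are at distance at
least `2 * δ` (`two_mul_le_dist_of_mem_gapSet`). Hence for small `ε` the preimages of the
`gapSet E δ σ` under `φ` with `#σ = i + 1` are `r`-disjoint, and these `n + 1` families cover `G`.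

The family of these preimages is in `𝔆`: by compactness, only finitely many vertices have a
coordinate `≥ δ` at some point of `f(X)` (`finite_large_coordinates`). If `φ g` is in
`gapSet E δ σ` and `w ∈ σ`, then `g⁻¹ • w` is one of these vertices `v`, so the preimage is contained
in the union of the finitely many sets `{g | g • v = w}`, each of which is empty or a left coset of the
stabilizer of `v`. Left translations being isometries, such pieces embed into the stabilizers
(`mem_of_subset_cosets`), and Finite Union Permanence applies.

The decomposition is required for every proper left invariant metric, while the hypotheses are about
one of them. Any two such metrics control each other (`exists_control`), which is enough for both
uses of the metric above.
-/

namespace CoarseFamilies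

universe u v w

open Filter

/-! ### Comparison of proper left invariant metrics -/

section Control

variable {G : Type u} [Group G]

/-- A left invariant metric is bounded above by a function of any proper left invariant one. -/
lemma exists_control {ρ ρ' : MetricSpace G}
    (hρ : ∀ g x y : G, ρ.dist (g * x) (g * y) = ρ.dist x y) (hρ' : IsProperLeftInvariant ρ') :
    ∃ β : ℝ≥0 → ℝ≥0, Monotone β ∧ Tendsto β atTop atTop ∧
      ∀ x y : G, ρ.toPseudoMetricSpace.toNNDist.nndist x y
        ≤ β (ρ'.toPseudoMetricSpace.toNNDist.nndist x y) := by
  have hfin : ∀ t : ℝ≥0, {g : G | ρ'.toPseudoMetricSpace.toNNDist.nndist 1 g ≤ t}.Finite := by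
    intro t
    refine (hρ'.2 1 t).subset fun g hg => ?_
    let := ρ'
    rw [Metric.mem_closedBall, dist_comm]
    exact_mod_cast hg
  let N : G → ℝ≥0 := fun g => ρ.toPseudoMetricSpace.toNNDist.nndist 1 g
  refine ⟨fun t => t + ∑ g ∈ (hfin t).toFinset, N g, ?_, ?_, ?_⟩
  · intro s t hst
    refine add_le_add hst (Finset.sum_le_sum_of_subset ?_)
    intro g hg
    simp only [Set.Finite.mem_toFinset, Set.mem_ofPred_eq] at hg ⊢
    exact hg.trans hst
  · exact tendsto_atTop_mono (fun t => le_self_add) tendsto_id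
  · intro x y
    have h1 : ρ.toPseudoMetricSpace.toNNDist.nndist x y = N (x⁻¹ * y) := by
      let := ρ
      have := hρ x⁻¹ x y
      rw [inv_mul_cancel] at this
      exact NNReal.coe_injective this.symm
    have h2 : ρ'.toPseudoMetricSpace.toNNDist.nndist x y
        = ρ'.toPseudoMetricSpace.toNNDist.nndist 1 (x⁻¹ * y) := by
      let := ρ'
      have := hρ'.1 x⁻¹ x y
      rw [inv_mul_cancel] at this
      exact NNReal.coe_injective this.symm
    rw [h1, h2]
    refine le_trans ?_ le_add_self
    refine Finset.single_le_sum (f := N) (fun _ _ => zero_le) ?_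
    simp

/-- A generalized inverse of a control function, which turns an upper bound `a ≤ β b` into a lower
bound of `b`. -/
lemma exists_lower_control (β : ℝ≥0 → ℝ≥0) (hβ : Monotone β) :
    ∃ δ : ℝ≥0 → ℝ≥0, Monotone δ ∧ Tendsto δ atTop atTop ∧ ∀ a b, a ≤ β b → δ a ≤ b := by
  have hbdd : ∀ t, BddAbove {s : ℝ≥0 | s ≤ t ∧ β s < t} := fun t => ⟨t, fun s hs => hs.1⟩
  refine ⟨fun t => sSup {s : ℝ≥0 | s ≤ t ∧ β s < t}, ?_, ?_, ?_⟩
  · intro s t hst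
    rcases Set.eq_empty_or_nonempty {a : ℝ≥0 | a ≤ s ∧ β a < s} with h | h
    · simp [h]
    · exact csSup_le_csSup (hbdd t) h fun a ha => ⟨ha.1.trans hst, ha.2.trans_le hst⟩
  · refine tendsto_atTop.2 fun s => ?_
    filter_upwards [eventually_ge_atTop s, eventually_gt_atTop (β s)] with t h1 h2
    exact le_csSup (hbdd t) ⟨h1, h2⟩
  · intro a b hab
    refine csSup_le' fun s hs => ?_
    by_contra! hlt
    exact absurd (hs.2.trans_le hab) (not_lt.2 (hβ hlt.le))

end Control

/-! ### Families of subsets of a group -/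

/-- The family of all subspaces that belong to a set of subsets of a metric space. -/
def familyOfSets {A : Type u} [MetricSpace A] (𝒮 : Set (Set A)) : MetricFamily.{u} :=
  ⟨MetSpc.sub '' 𝒮, inferInstance⟩

lemma CoarsePermanence.mem_of_maps_to_single {𝔆 : Set MetricFamily.{u}}
    (hCoarse : CoarsePermanence 𝔆) (𝒳 : MetricFamily.{u}) (Y : MetSpc.{u})
    (hY : MetricFamily.single Y ∈ 𝔆) (δ ϱ : ℝ≥0 → ℝ≥0) (hδ : Monotone δ) (hϱ : Monotone ϱ)
    (hδ' : Tendsto δ atTop atTop) (hϱ' : Tendsto ϱ atTop atTop)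
    (h : ∀ X ∈ 𝒳, ∃ f : X → Y, ∀ x y : X,
      δ (nndist x y) ≤ nndist (f x) (f y) ∧ nndist (f x) (f y) ≤ ϱ (nndist x y)) :
    𝒳 ∈ 𝔆 := by
  let F : FamilyMap 𝒳 (MetricFamily.single Y) :=
    { maps := fun X Y' => {f | ∀ x y : X.1,
        δ (nndist x y) ≤ nndist (f x) (f y) ∧ nndist (f x) (f y) ≤ ϱ (nndist x y)}
      exists_map := fun X => ⟨⟨Y, rfl⟩, h X.1 X.2⟩ }
  exact hCoarse 𝒳 _ F hY ⟨δ, ϱ, hδ, hϱ, hδ', hϱ', fun X Y f hf => hf⟩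

/-- A family of subsets of `G`, each of which is covered by one left coset (or none) of each of the
finitely many subgroups `H i`, is in `𝔆` if the subgroups are. The metric `ρ'` of the family and
the metric `ρ` of the subgroups may differ. -/
lemma mem_of_subset_cosets {𝔆 : Set MetricFamily.{u}} (hCoarse : CoarsePermanence 𝔆)
    (hUnion : FiniteUnionPermanence 𝔆) {G : Type u} [Group G] (ρ ρ' : MetricSpace G)
    (hρ : IsProperLeftInvariant ρ) (hρ' : IsProperLeftInvariant ρ')
    {m : ℕ} (hm : 1 ≤ m) (H : Fin m → Subgroup G)
    (hH : ∀ i, MetricFamily.single (@MetSpc.sub G ρ (H i : Set G)) ∈ 𝔆) (𝒮 : Set (Set G))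
    (hS : ∀ S ∈ 𝒮, ∃ g : Fin m → G, ∀ x ∈ S, ∃ i, (g i)⁻¹ * x ∈ H i) :
    @familyOfSets G ρ' 𝒮 ∈ 𝔆 := by
  obtain ⟨ϱ, hϱ, hϱ', hϱle⟩ := exists_control hρ.1 hρ'
  obtain ⟨β, hβ, -, hβle⟩ := exists_control hρ'.1 hρ
  obtain ⟨δ, hδ, hδ', hδle⟩ := exists_lower_control β hβ
  -- The pieces of a member `S` of the family are subsets of the subtype `S`, not of `G`.
  let 𝒳s : Fin m → MetricFamily.{u} := fun i =>
    ⟨(fun p : Σ S : Set G, Set S => letI := ρ'; MetSpc.sub p.2) ''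
      {p | ∃ g : G, ∀ x ∈ p.2, g⁻¹ * (x : G) ∈ H i}, inferInstance⟩
  refine hUnion m hm _ 𝒳s (fun i => ?_) ?_
  · refine hCoarse.mem_of_maps_to_single _ _ (hH i) δ ϱ hδ hϱ hδ' hϱ' ?_
    rintro _ ⟨⟨S, T⟩, ⟨g, hg⟩, rfl⟩
    refine ⟨fun x => ⟨g⁻¹ * (x.1 : G), hg x.1 x.2⟩, fun x y => ?_⟩
    have key : ρ.toPseudoMetricSpace.toNNDist.nndist (g⁻¹ * (x.1 : G)) (g⁻¹ * (y.1 : G))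
        = ρ.toPseudoMetricSpace.toNNDist.nndist (x.1 : G) (y.1 : G) := by
      let := ρ
      exact NNReal.coe_injective (hρ.1 _ _ _)
    change δ (ρ'.toPseudoMetricSpace.toNNDist.nndist (x.1 : G) (y.1 : G)) ≤
      ρ.toPseudoMetricSpace.toNNDist.nndist (g⁻¹ * (x.1 : G)) (g⁻¹ * (y.1 : G)) ∧
      ρ.toPseudoMetricSpace.toNNDist.nndist (g⁻¹ * (x.1 : G)) (g⁻¹ * (y.1 : G)) ≤
      ϱ (ρ'.toPseudoMetricSpace.toNNDist.nndist (x.1 : G) (y.1 : G))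
    rw [key]
    exact ⟨hδle _ _ (hβle _ _), hϱle _ _⟩
  · rintro _ ⟨S, hSS, rfl⟩
    obtain ⟨g, hg⟩ := hS S hSS
    refine ⟨fun i => {x : S | (g i)⁻¹ * (x : G) ∈ H i}, fun i => ?_, ?_⟩
    · exact ⟨⟨S, {x : S | (g i)⁻¹ * (x : G) ∈ H i}⟩, ⟨g i, fun x hx => hx⟩, rfl⟩
    · refine Set.eq_univ_of_forall fun x => ?_
      obtain ⟨i, hi⟩ := hg x.1 x.2
      exact Set.mem_iUnion.2 ⟨i, hi⟩

/-! ### Decomposition of a finite-dimensional uniform simplicial complex -/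

section Complex

variable {V : Type w} {K : AbstractSimplicialComplex V}

lemma sum_abs_sub_le_dist (x y : Realization K) (s : Finset V) :
    ∑ v ∈ s, |x.1 v - y.1 v| ≤ dist x y := by
  classical
  change _ ≤ l1norm (x.1 - y.1)
  rw [l1norm_eq (x.1 - y.1) ((x.1 - y.1).support ∪ s) Finset.subset_union_left]
  exact Finset.sum_le_sum_of_subset_of_nonneg Finset.subset_union_right
    fun _ _ _ => abs_nonneg _

/-- The set of the points whose coordinates in `σ` are at least `δ` and exceed all other coordinates
by at least `δ`. The first condition follows from the second unless `σ` contains all vertices. -/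
def gapSet (K : AbstractSimplicialComplex V) (δ : ℝ) (σ : Finset V) : Set (Realization K) :=
  {x | ∀ v ∈ σ, δ ≤ x.1 v ∧ ∀ u ∉ σ, x.1 u + δ ≤ x.1 v}

lemma two_mul_le_dist_of_mem_gapSet {δ : ℝ} {σ τ : Finset V} (hne : σ ≠ τ)
    (hcard : σ.card = τ.card) {x y : Realization K} (hx : x ∈ gapSet K δ σ)
    (hy : y ∈ gapSet K δ τ) : 2 * δ ≤ dist x y := by
  classical
  obtain ⟨v, hv, hv'⟩ : ∃ v ∈ σ, v ∉ τ := by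
    by_contra! hc
    exact hne (Finset.eq_of_subset_of_card_le hc hcard.ge)
  obtain ⟨u, hu, hu'⟩ : ∃ u ∈ τ, u ∉ σ := by
    by_contra! hc
    exact hne (Finset.eq_of_subset_of_card_le hc hcard.le).symm
  have huv : v ≠ u := fun e => hv' (e ▸ hu)
  have h1 := (hx v hv).2 u hu'
  have h2 := (hy u hu).2 v hv'
  have h3 := sum_abs_sub_le_dist x y {v, u}
  rw [Finset.sum_pair huv] at h3
  have h4 := le_abs_self (x.1 v - y.1 v)
  have h5 := neg_abs_le (x.1 u - y.1 u)
  linarith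

/-- In dimension at most `n`, the `gapSet`s with `δ = 1 / (n + 1) ^ 2` cover the complex. The
largest coordinate of a point is at least `1 / (n + 1)`, and the at most `n` other positive
coordinates miss the interior of one of the `n + 1` intervals `[k * δ, (k + 1) * δ]`, `k ≤ n`. -/
lemma exists_mem_gapSet {n : ℕ} (hK : DimLE K n) (x : Realization K) :
    ∃ σ : Finset V, σ.Nonempty ∧ σ.card ≤ n + 1 ∧ x ∈ gapSet K (1 / ((n : ℝ) + 1) ^ 2) σ := by
  classical
  set δ : ℝ := 1 / ((n : ℝ) + 1) ^ 2 with hδ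
  have hn : (0 : ℝ) < (n : ℝ) + 1 := by positivity
  have hδ0 : 0 < δ := by positivity
  have hsum : ∑ v ∈ x.1.support, x.1 v = 1 := x.2.2.1
  have hcard : x.1.support.card ≤ n + 1 := hK _ x.2.2.2
  obtain ⟨m, hm, hmδ⟩ : ∃ m ∈ x.1.support, ((n : ℝ) + 1) * δ ≤ x.1 m := by
    by_contra! hc
    have hne : x.1.support.Nonempty := by
      by_contra he
      rw [Finset.not_nonempty_iff_eq_empty.1 he] at hsum
      simp at hsum
    have h1 := Finset.sum_lt_sum_of_nonempty hne hc
    rw [hsum, Finset.sum_const, nsmul_eq_mul] at h1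
    have h2 : (x.1.support.card : ℝ) ≤ (n : ℝ) + 1 := by exact_mod_cast hcard
    have h3 : ((n : ℝ) + 1) * (((n : ℝ) + 1) * δ) = 1 := by
      rw [hδ]
      field_simp
    have h4 := mul_le_mul_of_nonneg_right h2 (mul_pos hn hδ0).le
    linarith
  obtain ⟨k, hk⟩ : ∃ k : Fin (n + 1), ∀ v, x.1 v ≤ k * δ ∨ ((k : ℝ) + 1) * δ ≤ x.1 v := by
    by_contra! hc
    choose c hc1 hc2 using hc
    have hinj : Function.Injective c := by
      -- A coordinate is in the interior of at most one of the intervals.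
      have hlt : ∀ i j, c i = c j → (i : ℕ) ≤ j := by
        intro i j hij
        have h1 := hc1 i
        rw [hij] at h1
        have h2 := lt_of_mul_lt_mul_right (h1.trans (hc2 j)) hδ0.le
        have h3 : (i : ℕ) < j + 1 := by exact_mod_cast h2
        omega
      intro i j hij
      exact Fin.ext (le_antisymm (hlt i j hij) (hlt j i hij.symm))
    have hmem : ∀ i, c i ∈ x.1.support.erase m := by
      intro i
      refine Finset.mem_erase.2 ⟨fun e => ?_, Finsupp.mem_support_iff.2 ?_⟩
      · have h1 := hc2 i
        rw [e] at h1
        have h2 : ((i : ℕ) : ℝ) + 1 ≤ (n : ℝ) + 1 := by exact_mod_cast i.2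
        have h3 := mul_le_mul_of_nonneg_right h2 hδ0.le
        linarith
      · exact ((mul_nonneg (Nat.cast_nonneg _) hδ0.le).trans_lt (hc1 i)).ne'
    have h1 := Finset.card_le_card_of_injOn (s := Finset.univ) c (fun i _ => hmem i)
      hinj.injOn
    rw [Finset.card_univ, Fintype.card_fin, Finset.card_erase_of_mem hm] at h1
    have := Finset.card_pos.2 ⟨m, hm⟩
    omega
  have hkδ : δ ≤ ((k : ℝ) + 1) * δ := by
    have : (0 : ℝ) ≤ (k : ℝ) * δ := by positivity
    linarith
  refine ⟨x.1.support.filter fun v => ((k : ℝ) + 1) * δ ≤ x.1 v, ⟨m, ?_⟩,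
    (Finset.card_filter_le _ _).trans hcard, ?_⟩
  · refine Finset.mem_filter.2 ⟨hm, le_trans ?_ hmδ⟩
    have h2 : ((k : ℕ) : ℝ) + 1 ≤ (n : ℝ) + 1 := by exact_mod_cast k.2
    exact mul_le_mul_of_nonneg_right h2 hδ0.le
  · intro v hv
    have hv' := (Finset.mem_filter.1 hv).2
    refine ⟨hkδ.trans hv', fun u hu => ?_⟩
    have hu' : x.1 u ≤ k * δ := by
      refine (hk u).resolve_right fun h => hu (Finset.mem_filter.2 ⟨?_, h⟩)
      exact Finsupp.mem_support_iff.2 (hδ0.trans_le (hkδ.trans h)).ne'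
    linarith

/-- A compact set of points has only finitely many coordinates that are not uniformly small, although
it need not be contained in a finite subcomplex. -/
lemma finite_large_coordinates {C : Set (Realization K)} (hC : IsCompact C) {δ : ℝ} (hδ : 0 < δ) :
    {v : V | ∃ x ∈ C, δ ≤ x.1 v}.Finite := by
  obtain ⟨t, -, ht, hCt⟩ := hC.finite_cover_balls hδ
  refine (ht.biUnion fun y _ => y.1.support.finite_toSet).subset ?_
  rintro v ⟨x, hx, hxv⟩
  obtain ⟨y, hy, hxy⟩ := Set.mem_iUnion₂.1 (hCt hx)
  refine Set.mem_iUnion₂.2 ⟨y, hy, Finsupp.mem_support_iff.2 fun h0 => ?_⟩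
  have h1 := sum_abs_sub_le_dist x y {v}
  rw [Finset.sum_singleton, h0, sub_zero] at h1
  have h2 := le_abs_self (x.1 v)
  have h3 := Metric.mem_ball.1 hxy
  linarith

end Complex

/-! ### Pulling the decomposition back to the group -/

/-- The map `g ↦ g • f (g⁻¹ • p)`. It is constant if `f` is equivariant; in general its variation
measures the failure of equivariance. -/
def twistedOrbit {G : Type u} [Group G] {X : Type v} [MulAction G X] {Y : Type w} [MulAction G Y]
    (f : X → Y) (p : X) (g : G) : Y :=
  g • f (g⁻¹ • p)

lemma dist_twistedOrbit_le {G : Type u} [Group G] [ρ : MetricSpace G] {X : Type v}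
    [MulAction G X] {Y : Type w} [MetricSpace Y] [MulAction G Y] [IsIsometricSMul G Y]
    (hG : ∀ g x y : G, dist (g * x) (g * y) = dist x y) {ε : ℝ} {f : X → Y}
    (hf : EquivariantUpTo G ε f) (p : X) (g h : G) :
    dist (twistedOrbit f p g) (twistedOrbit f p h) ≤ ε * dist g h := by
  obtain ⟨k, rfl⟩ : ∃ k, h = g * k := ⟨g⁻¹ * h, by group⟩
  have h1 : dist g (g * k) = dist 1 k := by simpa using hG g 1 k
  have h2 := hf k (k⁻¹ • g⁻¹ • p)
  rw [smul_inv_smul] at h2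
  rw [h1, twistedOrbit, twistedOrbit, mul_smul g k, dist_smul, mul_inv_rev, mul_smul]
  exact h2

lemma inv_smul_mem_of_twistedOrbit_mem_gapSet {G : Type u} [Group G] {X : Type v} [MulAction G X]
    {V : Type w} [MulAction G V] {K : AbstractSimplicialComplex V} [IsSimplicialAction G K]
    {f : X → Realization K} {p : X} {δ : ℝ} {σ : Finset V} {g : G}
    (hg : twistedOrbit f p g ∈ gapSet K δ σ) {w : V} (hw : w ∈ σ) :
    g⁻¹ • w ∈ {v : V | ∃ x ∈ Set.range f, δ ≤ x.1 v} :=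
  ⟨_, ⟨g⁻¹ • p, rfl⟩, (hg w hw).1⟩

end CoarseFamilies

universe u v w

open CoarseFamilies in
theorem theorem3p7 (𝔆 : Set MetricFamily.{u})
    (hCoarse : CoarsePermanence 𝔆)
    (hAmalg : FiniteAmalgamationPermanence 𝔆)
    (hUnion : FiniteUnionPermanence 𝔆)
    (G : Type u) [Group G] [Countable G]
    (ρ : MetricSpace G) (hρ : IsProperLeftInvariant ρ)
    (n : ℕ)
    (h : ∀ ε : ℝ, 0 < ε →
      ∃ (X : Type v) (_ : TopologicalSpace X) (_ : CompactSpace X) (_ : Nonempty X)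
        (_ : MulAction G X) (_ : ContinuousConstSMul G X)
        (V : Type w) (_ : MulAction G V) (E : AbstractSimplicialComplex V)
        (_ : IsSimplicialAction G E) (f : X → Realization E),
        Continuous f ∧
        DimLE E n ∧
        EquivariantUpTo G ε f ∧
        ∀ v : V, MetricFamily.single (MetSpc.sub (MulAction.stabilizer G v : Set G)) ∈ 𝔆) :
    GroupNDecomposable n G 𝔆 ∧ (StableUnderWeakDecomposition 𝔆 → GroupMem G 𝔆) := by
  suffices hdec : GroupNDecomposable n G 𝔆 from
    ⟨hdec, fun hst ρ' hρ' => hst _ ⟨n, hdec ρ' hρ'⟩⟩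
  intro ρ' hρ' r hr
  obtain ⟨β, hβ, -, hβle⟩ := exists_control hρ.1 hρ'
  -- Points at `ρ'`-distance at most `r` are at `ρ`-distance at most `R`.
  let R : ℝ := (β ⟨r, hr.le⟩).toReal
  have hR0 : 0 ≤ R := NNReal.coe_nonneg _
  have hRle : ∀ x y : G, ρ'.dist x y ≤ r → ρ.dist x y ≤ R := by
    intro x y hxy
    exact (NNReal.coe_le_coe.2 (hβle x y)).trans (NNReal.coe_le_coe.2 (hβ hxy))
  set δ : ℝ := 1 / ((n : ℝ) + 1) ^ 2
  have hδ0 : 0 < δ := by positivity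
  -- With this `ε`, points at `ρ'`-distance at most `r` have images at distance less than `2 * δ`.
  have hε0 : 0 < δ / (R + 1) := by positivity
  have hεR : δ / (R + 1) * R < 2 * δ := by
    have : δ / (R + 1) * (R + 1) = δ := div_mul_cancel₀ _ (by positivity)
    linarith
  obtain ⟨X, _, _, ⟨p⟩, _, _, V, _, E, _, f, hfc, hdim, hfe, hstab⟩ := h _ hε0
  have hφ := dist_twistedOrbit_le (ρ := ρ) hρ.1 hfe p
  set φ : G → Realization E := twistedOrbit f p
  have hPfin := finite_large_coordinates (isCompact_range hfc) hδ0
  set P : Set V := {v : V | ∃ x ∈ Set.range f, δ ≤ x.1 v}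
  have hmemP : ∀ (σ : Finset V) (g : G), φ g ∈ gapSet E δ σ → ∀ w ∈ σ, g⁻¹ • w ∈ P :=
    fun σ g hg w hw => inv_smul_mem_of_twistedOrbit_mem_gapSet hg hw
  have hPne : P.Nonempty := by
    obtain ⟨σ, ⟨w, hw⟩, -, hσ⟩ := exists_mem_gapSet hdim (φ 1)
    exact ⟨_, hmemP σ 1 hσ w hw⟩
  have : Finite P := hPfin
  have : Nonempty P := hPne.to_subtype
  have hm : 1 ≤ Nat.card P := Nat.card_pos
  let e : Fin (Nat.card P) ≃ P := (Finite.equivFin P).symm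
  refine ⟨@familyOfSets G ρ' {S | ∃ σ : Finset V, σ.Nonempty ∧ S = φ ⁻¹' gapSet E δ σ}, ?_, ?_⟩
  · refine mem_of_subset_cosets hCoarse hUnion ρ ρ' hρ hρ' hm
      (fun i => MulAction.stabilizer G (e i : V)) (fun i => hstab _) _ ?_
    rintro _ ⟨σ, ⟨w, hw⟩, rfl⟩
    -- `c i` represents the coset of the elements that map the vertex `e i` to `w`.
    have hc : ∀ i, ∃ c : G, (∃ g : G, g • (e i : V) = w) → c • (e i : V) = w := by
      intro i
      by_cases hex : ∃ g : G, g • (e i : V) = w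
      · exact ⟨hex.choose, fun _ => hex.choose_spec⟩
      · exact ⟨1, fun h => absurd h hex⟩
    choose c hc using hc
    refine ⟨c, fun g hg => ?_⟩
    obtain ⟨i, hi⟩ := e.surjective ⟨g⁻¹ • w, hmemP σ g hg w hw⟩
    have hgi : g • (e i : V) = w := by rw [hi, smul_inv_smul]
    refine ⟨i, ?_⟩
    rw [MulAction.mem_stabilizer_iff, mul_smul, hgi, inv_smul_eq_iff, hc i ⟨g, hgi⟩]
  · rintro _ rfl
    refine ⟨fun i => {S | ∃ σ : Finset V, σ.card = (i : ℕ) + 1 ∧ S = φ ⁻¹' gapSet E δ σ},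
      ?_, fun i => ⟨?_, ?_⟩⟩
    · refine Set.eq_univ_of_forall fun g => ?_
      obtain ⟨σ, hne, hcard, hσ⟩ := exists_mem_gapSet hdim (φ g)
      have hpos := hne.card_pos
      refine Set.mem_iUnion.2 ⟨⟨σ.card - 1, by omega⟩, _, ⟨σ, ?_, rfl⟩, hσ⟩
      change σ.card = σ.card - 1 + 1
      omega
    · rintro _ ⟨σ, hσ, rfl⟩ _ ⟨τ, hτ, rfl⟩ hne x hx y hy
      by_contra! hxy
      have h1 := two_mul_le_dist_of_mem_gapSet (fun e => hne (by rw [e])) (hσ.trans hτ.symm)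
        hx hy
      have h2 := mul_le_mul_of_nonneg_left (hRle x y hxy) hε0.le
      exact absurd (h1.trans ((hφ x y).trans h2)) (not_le.2 hεR)
    · rintro _ ⟨σ, hσ, rfl⟩
      exact ⟨_, ⟨σ, Finset.card_pos.1 (by omega), rfl⟩, rfl⟩
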